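/- Let $T$ be a complete first-order theory. A formula $\varphi(x,y)$, where $x,y$ are finite tuples of variables, is NIP in $T$ if in no model of $T$ are there tuples $(a_t)_{t\in\omega}$ and $(b_s)_{s\subseteq\omega}$ such that $\varphi(a_t,b_s)$ holds if and only if $t\in s$; the theory $T$ is NIP if every formula $\varphi(x,y)$ is NIP in $T$. Theorem. Let $T$ be NIP. Then $T$ satisfies UDTFS (uniform definability of types over finite sets): for every formula $\varphi(x,y)$ there is a formula $\theta(x,z)$, with $z$ a finite tuple of variables, such that for every model $M\models T$, every finite set $A\subseteq M$ with $|A|\ge 2$ and every tuple $a$ from $M$ of length $|y|$ there is a tuple $b\in A^{|z|}$ with $\varphi(A,a)=\theta(A,b)$, where $\varphi(A,a)=\{c\in A^{|x|} : M\models\varphi(c,a)\}$ and $\theta(A,b)=\{c\in A^{|x|} : M\models\theta(c,b)\}$. All formulas are without parameters. -/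

import Mathlib

universe u v w

namespace FirstOrder.Language

/-- The trace `φ(A, a) = {c ∈ Aⁿ : M ⊨ φ(c, a)}`, where `x` has length `n` and `y` length `m`. -/
def Formula.trace {L : Language.{u, v}} {M : Type w} [L.Structure M] {n m : ℕ}
    (φ : L.Formula (Fin n ⊕ Fin m)) (A : Set M) (a : Fin m → M) : Set (Fin n → M) :=
  {c | (∀ i, c i ∈ A) ∧ φ.Realize (Sum.elim c a)}

/-- `φ(x, y)` is NIP in `T`: no model of `T` contains tuples `(a_t)` for `t ∈ ω` and `(b_s)` for
`s ⊆ ω` such that `φ(a_t, b_s) ↔ t ∈ s`.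
(By compactness and Löwenheim–Skolem, models in the universe `max u v` are enough.) -/
def Theory.FormulaIsNIP {L : Language.{u, v}} (T : L.Theory) {n m : ℕ}
    (φ : L.Formula (Fin n ⊕ Fin m)) : Prop :=
  ∀ (M : Type (max u v)) [L.Structure M] [Nonempty M] [M ⊨ T],
    ¬ ∃ (a : ℕ → Fin n → M) (b : Set ℕ → Fin m → M),
      ∀ (t : ℕ) (s : Set ℕ), φ.Realize (Sum.elim (a t) (b s)) ↔ t ∈ s

/-- `T` is NIP: every formula `φ(x, y)` is NIP in `T`. -/
def Theory.IsNIP {L : Language.{u, v}} (T : L.Theory) : Prop :=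
  ∀ (n m : ℕ) (φ : L.Formula (Fin n ⊕ Fin m)), T.FormulaIsNIP φ

/-- `φ(x, y)` has uniform definability of types over finite sets in `T`: there is `θ(x, z)`,
without parameters, such that in every model of `T`, for every finite set `A` with at least two
elements and every tuple `a` there is a tuple `b` of elements of `A` with `φ(A, a) = θ(A, b)`. -/
def Theory.FormulaHasUDTFS {L : Language.{u, v}} (T : L.Theory) {n m : ℕ}
    (φ : L.Formula (Fin n ⊕ Fin m)) : Prop :=
  ∃ (k : ℕ) (θ : L.Formula (Fin n ⊕ Fin k)),
    ∀ (M : Type w) [L.Structure M] [Nonempty M] [M ⊨ T] (A : Set M),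
      A.Finite → 2 ≤ A.ncard → ∀ a : Fin m → M,
        ∃ b : Fin k → M, (∀ j, b j ∈ A) ∧ φ.trace A a = θ.trace A b

/-- `T` satisfies UDTFS: every formula `φ(x, y)` has UDTFS in `T`. -/
def Theory.SatisfiesUDTFS {L : Language.{u, v}} (T : L.Theory) : Prop :=
  ∀ (n m : ℕ) (φ : L.Formula (Fin n ⊕ Fin m)), Theory.FormulaHasUDTFS.{u, v, w} T φ

end FirstOrder.Language

/-! The trace of `φ(·, a)` on `A` is learned from boundedly many sample points of `A`. NIP bounds
the VC dimension of `φ`, so by Sauer–Shelah a sample of `s + 1` tuples has only polynomially many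
traces, fewer than `2 ^ (k + 1)` for `s` about `8 * k`. The one-inclusion graph of so small a family
yields a leave-one-out predictor with at most `k` mistakes (`exists_predictor`). Averaging over
samples, every distribution on tuples from `A` admits a hypothesis of error below 1/8, definable
over a sample in `A` (`exists_leaveOneOut_error_le`).

Minimax turns this into one distribution on hypotheses that is right at each point with probability
above 7/8, so points on opposite sides of the trace are told apart with probability at least 3/4.
The dual of the hypothesis formula is NIP too, so an ε-net argument (`exists_transversal`) finds
boundedly many hypotheses separating all such pairs, and the trace is a Boolean combination of them.
Only finitely many combinations occur; two distinct elements of `A` code the one used. -/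

open Finset

/-! ### Sauer–Shelah bound on traces -/

/-- The subsets of `ι` cut out, along the points `p i`, by the sets `{x | R x b}`. -/
noncomputable def traces {X B ι : Type*} [Fintype ι] (R : X → B → Prop) (p : ι → X) :
    Finset (Finset ι) :=
  open Classical in univ.filter fun S => ∃ b, ∀ i, i ∈ S ↔ R (p i) b

lemma mem_traces {X B ι : Type*} [Fintype ι] {R : X → B → Prop} {p : ι → X} {S : Finset ι} :
    S ∈ traces R p ↔ ∃ b, ∀ i, i ∈ S ↔ R (p i) b := by
  classical
  simp [traces]

/-- Sauer–Shelah: `d` indices from a larger shattered index set would give a tuple contradicting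
`hR`. No injectivity of `p` is needed. -/
lemma card_traces_le {X B ι : Type*} [Fintype ι] {R : X → B → Prop} {d : ℕ}
    (hR : ∀ a : Fin d → X, ¬ ∀ s : Set (Fin d), ∃ b, ∀ i, R (a i) b ↔ i ∈ s) (p : ι → X) :
    #(traces R p) ≤ (Fintype.card ι + 1) ^ d := by
  classical
  have hv : (traces R p).vcDim ≤ d := by
    refine Finset.sup_le fun s hs => ?_
    rw [mem_shatterer] at hs
    by_contra! hd
    obtain ⟨e⟩ : Nonempty (Fin d ↪ s) := by
      apply Function.Embedding.nonempty_of_card_le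
      simpa using hd.le
    refine hR (fun i => p (e i)) fun t => ?_
    obtain ⟨u, hu, hut⟩ := hs (t := s.filter fun x => ∃ i ∈ t, (e i : ι) = x) (filter_subset _ _)
    obtain ⟨b, hb⟩ := mem_traces.1 hu
    refine ⟨b, fun i => ?_⟩
    rw [← hb]
    have h1 : (e i : ι) ∈ s ∩ u ↔ (e i : ι) ∈ s.filter fun x => ∃ i ∈ t, (e i : ι) = x := by
      rw [hut]
    simpa [Subtype.ext_iff.symm] using h1
  have h1 := (card_le_card_shatterer (traces R p)).trans card_shatterer_le_sum_vcDim
  refine h1.trans ?_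
  calc ∑ k ∈ Iic (traces R p).vcDim, (Fintype.card ι).choose k
      ≤ ∑ k ∈ Finset.range (d + 1), (Fintype.card ι).choose k := by
        apply sum_le_sum_of_subset
        intro k hk
        simp at hk ⊢
        omega
    -- The factor `d.choose k ≥ 1` completes the sum to a binomial expansion.
    _ ≤ ∑ k ∈ Finset.range (d + 1), (Fintype.card ι) ^ k * 1 ^ (d - k) * d.choose k := by
        refine sum_le_sum fun k hk => ?_
        have : 0 < d.choose k := Nat.choose_pos (by simpa [Nat.lt_succ_iff] using hk)
        calc _ ≤ (Fintype.card ι) ^ k := Nat.choose_le_pow _ _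
          _ ≤ _ := by simpa using Nat.le_mul_of_pos_right _ this
    _ = _ := (add_pow _ _ _).symm

/-! ### Leave-one-out prediction by the one-inclusion graph -/

/-- A finite family of sets has a member with few neighbours at Hamming distance one. -/
lemma exists_two_pow_card_neighbors_le {ι : Type*} [Fintype ι] [DecidableEq ι]
    (V : Finset (Finset ι)) (hV : V.Nonempty) :
    ∃ v ∈ V, 2 ^ #{i | symmDiff v {i} ∈ V} ≤ #V := by
  induction V using Finset.strongInduction with
  | H V ih =>
    by_cases h : ∃ i, (∃ v ∈ V, i ∈ v) ∧ ∃ v ∈ V, i ∉ v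
    · obtain ⟨i, ⟨v₁, hv₁, hi₁⟩, ⟨v₀, hv₀, hi₀⟩⟩ := h
      -- A set in the smaller half `W` has all its neighbours in `W`, except possibly the one in
      -- direction `i`: the degree grows by at most one while the size at least doubles.
      have key : ∀ W ⊂ V, W.Nonempty → 2 * #W ≤ #V →
          (∀ v ∈ W, ∀ u ∈ V, (i ∈ u ↔ i ∈ v) → u ∈ W) →
          ∃ v ∈ V, 2 ^ #{i | symmDiff v {i} ∈ V} ≤ #V := by
        intro W hW hne hc hsep
        obtain ⟨v, hv, hd⟩ := ih W hW hne
        refine ⟨v, hW.1 hv, ?_⟩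
        have hsub : (univ.filter fun j => symmDiff v {j} ∈ V) ⊆
            insert i (univ.filter fun j => symmDiff v {j} ∈ W) := by
          intro j hj
          rw [mem_filter] at hj
          by_cases hji : j = i
          · simp [hji]
          · refine mem_insert_of_mem (mem_filter.2 ⟨mem_univ _, hsep v hv _ hj.2 ?_⟩)
            simp [mem_symmDiff, Ne.symm hji]
        calc 2 ^ #{i | symmDiff v {i} ∈ V} ≤ 2 ^ (#{i | symmDiff v {i} ∈ W} + 1) :=
              Nat.pow_le_pow_right (by norm_num) ((card_le_card hsub).trans (card_insert_le _ _))
          _ = 2 * 2 ^ #{i | symmDiff v {i} ∈ W} := by ring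
          _ ≤ #V := by omega
      have hcard := card_filter_add_card_filter_not (s := V) (fun v => i ∈ v)
      rcases le_total (#(V.filter fun v => i ∈ v)) (#(V.filter fun v => i ∉ v)) with hle | hle
      · refine key (V.filter fun v => i ∈ v) ?_ ⟨v₁, by simp [*]⟩ (by omega) ?_
        · exact filter_ssubset.2 ⟨v₀, hv₀, hi₀⟩
        · simp only [mem_filter]
          tauto
      · refine key (V.filter fun v => i ∉ v) ?_ ⟨v₀, by simp [*]⟩ (by omega) ?_
        · exact filter_ssubset.2 ⟨v₁, hv₁, by simpa⟩
        · simp only [mem_filter]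
          tauto
    · push Not at h
      obtain ⟨v, hv⟩ := hV
      refine ⟨v, hv, ?_⟩
      have : (univ.filter fun i => symmDiff v {i} ∈ V) = ∅ := by
        refine filter_eq_empty_iff.2 fun i _ hi => ?_
        by_cases hiv : i ∈ v
        · have := h i ⟨v, hv, hiv⟩ _ hi
          simp [mem_symmDiff, hiv] at this
        · exact hiv (h i ⟨_, hi, by simp [mem_symmDiff, hiv]⟩ v hv)
      rw [this]
      simpa using card_pos.2 ⟨v, hv⟩

/-- Membership of `i` in a set from a small family can be predicted from the rest of the set with
few errors. -/
lemma exists_predictor {ι : Type*} [Fintype ι] [DecidableEq ι] (k : ℕ)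
    (V : Finset (Finset ι)) (hV : #V < 2 ^ (k + 1)) :
    ∃ P : ι → Finset ι → Prop, ∀ v ∈ V, {i | ¬ (P i (v.erase i) ↔ i ∈ v)}.ncard ≤ k := by
  classical
  induction V using Finset.strongInduction with
  | H V ih =>
    rcases V.eq_empty_or_nonempty with rfl | hne
    · exact ⟨fun _ _ => True, by simp⟩
    obtain ⟨v, hv, hd⟩ := exists_two_pow_card_neighbors_le V hne
    have hk : #{i | symmDiff v {i} ∈ V} ≤ k :=
      Nat.lt_succ_iff.1 ((Nat.pow_lt_pow_iff_right (by norm_num)).1 (hd.trans_lt hV))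
    obtain ⟨P, hP⟩ := ih (V.erase v) (erase_ssubset hv) ((card_erase_le).trans_lt hV)
    -- Where `S` fits `v`, follow the neighbour of `v` if it lies in `V`, and `v` otherwise.
    -- Mistakes on `v` then occur only at its neighbours, at most `k`; any other set is either
    -- predicted correctly here or left to `P`.
    refine ⟨fun i S => if S = v.erase i then ¬ (i ∈ v ↔ symmDiff v {i} ∈ V) else P i S, ?_⟩
    intro w hw
    by_cases hwv : w = v
    · subst hwv
      refine le_trans ?_ hk
      rw [← Set.ncard_coe_finset]
      refine Set.ncard_le_ncard ?_ (Set.toFinite _)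
      intro i hi
      simp only [Set.mem_ofPred_eq, if_true] at hi
      simp only [coe_filter, mem_univ, true_and, Set.mem_ofPred_eq]
      tauto
    · refine le_trans (Set.ncard_le_ncard ?_ (Set.toFinite _)) (hP w (mem_erase.2 ⟨hwv, hw⟩))
      intro i hi
      simp only [Set.mem_ofPred_eq] at hi ⊢
      split_ifs at hi with h
      · exfalso
        have hiff : ¬ (i ∈ w ↔ i ∈ v) := by
          intro hh
          apply hwv
          ext j
          by_cases hj : j = i
          · rw [hj, hh]
          · have : j ∈ w.erase i ↔ j ∈ v.erase i := by rw [h]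
            simpa [hj] using this
        have : symmDiff v {i} = w := by
          ext j
          by_cases hj : j = i
          · subst hj
            simp [mem_symmDiff]
            tauto
          · have : j ∈ w.erase i ↔ j ∈ v.erase i := by rw [h]
            simp only [mem_erase, ne_eq, hj, not_false_eq_true, true_and] at this
            simp [mem_symmDiff, hj, this]
        rw [this] at hi
        tauto
      · exact hi

/-- A predictor for membership with few leave-one-out errors on small families. -/
noncomputable def leaveOneOut {ι : Type*} [Fintype ι] [DecidableEq ι] (k : ℕ)
    (V : Finset (Finset ι)) : ι → Finset ι → Prop :=
  if h : #V < 2 ^ (k + 1) then (exists_predictor k V h).choose else fun _ _ => True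

lemma ncard_leaveOneOut_le {ι : Type*} [Fintype ι] [DecidableEq ι] {k : ℕ}
    {V : Finset (Finset ι)} (h : #V < 2 ^ (k + 1)) {v : Finset ι} (hv : v ∈ V) :
    {i | ¬ (leaveOneOut k V i (v.erase i) ↔ i ∈ v)}.ncard ≤ k := by
  rw [leaveOneOut, dif_pos h]
  exact (exists_predictor k V h).choose_spec v hv

open Classical in
/-- Leave-one-out prediction from a suitable sample has small error. -/
lemma exists_leaveOneOut_error_le {X B : Type*} [Fintype X] (R : X → B → Prop) {s k : ℕ}
    (hR : ∀ p : Fin (s + 1) → X, #(traces R p) < 2 ^ (k + 1)) (b : B) (μ : X → ℝ)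
    (hμ : ∀ x, 0 ≤ μ x) (hμ1 : ∑ x, μ x = 1) :
    ∃ (i : Fin (s + 1)) (l : Finset (Fin (s + 1))) (Y : Fin s → X),
      (∑ x, if leaveOneOut k (traces R (i.insertNth x Y : Fin (s + 1) → X)) i l ↔ R x b
        then 0 else μ x) ≤ k / (s + 1) := by
  -- Draw `s + 1` points independently from `μ`. At most `k` leave-one-out mistakes are expected,
  -- yet under `hcon` each position errs with probability above `k / (s + 1)`.
  by_contra! hcon
  let l : Fin (s + 1) → (Fin s → X) → Finset (Fin (s + 1)) := fun i Y =>
    univ.filter fun j => ∃ j', j = i.succAbove j' ∧ R (Y j') b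
  let S : (Fin (s + 1) → X) → Finset (Fin (s + 1)) := fun p => univ.filter fun j => R (p j) b
  -- The labels without position `i` do not depend on `x`, so `x` can be averaged with `i`, `Y` and
  -- the labels fixed.
  have hS : ∀ i x Y, (S (i.insertNth x Y)).erase i = l i Y := by
    intro i x Y
    ext j
    rcases Fin.eq_self_or_eq_succAbove i j with rfl | ⟨j, rfl⟩
    · simp [S, l, (Fin.succAbove_ne _ _).symm]
    · simp [S, l, Fin.succAbove_ne]
  let W : (Fin (s + 1) → X) → Fin (s + 1) → ℝ := fun p i =>
    if leaveOneOut k (traces R p) i ((S p).erase i) ↔ i ∈ S p then 0 else 1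
  have hW : ∀ p, ∑ i, W p i ≤ k := by
    intro p
    have h1 : S p ∈ traces R p := mem_traces.2 ⟨b, by simp [S]⟩
    have h2 := ncard_leaveOneOut_le (hR p) h1
    have h3 : ∑ i, W p i =
        (#(univ.filter fun i => ¬ (leaveOneOut k (traces R p) i ((S p).erase i) ↔ i ∈ S p)) : ℝ) := by
      rw [card_filter]
      push_cast
      refine sum_congr rfl fun i _ => ?_
      by_cases h : leaveOneOut k (traces R p) i ((S p).erase i) ↔ i ∈ S p <;> simp [W, h]
    rw [h3]
    rw [← Set.ncard_coe_finset]
    simpa using h2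
  have hup : ∑ p : Fin (s + 1) → X, ∑ i, (∏ j, μ (p j)) * W p i ≤ k := by
    calc _ ≤ ∑ p : Fin (s + 1) → X, (∏ j, μ (p j)) * k := by
          refine sum_le_sum fun p _ => ?_
          rw [← mul_sum]
          exact mul_le_mul_of_nonneg_left (hW p) (prod_nonneg fun j _ => hμ _)
      _ = k := by rw [← sum_mul, ← Fintype.sum_pow, hμ1]; simp
  rw [sum_comm] at hup
  have hlow : ∀ i : Fin (s + 1),
      (k : ℝ) / (s + 1) < ∑ p : Fin (s + 1) → X, (∏ j, μ (p j)) * W p i := by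
    intro i
    rw [← Fintype.sum_equiv (Fin.insertNthEquiv (fun _ => X) i)
      (fun q => (μ q.1 * ∏ j, μ (q.2 j)) * W (i.insertNth q.1 q.2) i)]
    · rw [Fintype.sum_prod_type_right]
      have h0 : ∀ Y : Fin s → X, (∏ j, μ (Y j)) * ((k : ℝ) / (s + 1)) ≤
          (∏ j, μ (Y j)) * ∑ x, (if leaveOneOut k
            (traces R (i.insertNth x Y : Fin (s + 1) → X)) i (l i Y) ↔ R x b then 0 else μ x) :=
        fun Y => mul_le_mul_of_nonneg_left (hcon i (l i Y) Y).le (prod_nonneg fun j _ => hμ _)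
      have h1 : ∑ Y : Fin s → X, ∏ j, μ (Y j) = 1 := by rw [← Fintype.sum_pow, hμ1]; simp
      obtain ⟨Y0, -, hY0⟩ : ∃ Y ∈ (univ : Finset (Fin s → X)), 0 < ∏ j, μ (Y j) := by
        apply exists_lt_of_sum_lt
        simp [h1]
      calc (k : ℝ) / (s + 1) = ∑ Y : Fin s → X, (∏ j, μ (Y j)) * ((k : ℝ) / (s + 1)) := by
            rw [← sum_mul, h1, one_mul]
        _ < ∑ Y : Fin s → X, (∏ j, μ (Y j)) * ∑ x, (if leaveOneOut k
            (traces R (i.insertNth x Y : Fin (s + 1) → X)) i (l i Y) ↔ R x b then 0 else μ x) :=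
          sum_lt_sum (fun Y _ => h0 Y)
            ⟨Y0, mem_univ _, mul_lt_mul_of_pos_left (hcon i (l i Y0) Y0) hY0⟩
        _ = _ := by
          refine sum_congr rfl fun Y _ => ?_
          rw [mul_sum]
          refine sum_congr rfl fun x _ => ?_
          have hx : i ∈ S (i.insertNth x Y) ↔ R x b := by simp [S]
          simp only [W, hS, hx]
          split_ifs <;> ring
    · rintro ⟨x, Y⟩
      simp only [Fin.insertNthEquiv_apply, Fin.prod_univ_succAbove _ i, Fin.insertNth_apply_same,
        Fin.insertNth_apply_succAbove]
      rfl
  have : (k : ℝ) < ∑ i : Fin (s + 1), ∑ p : Fin (s + 1) → X, (∏ j, μ (p j)) * W p i := by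
    calc (k : ℝ) = ∑ i : Fin (s + 1), (k : ℝ) / (s + 1) := by
          simp; field_simp
      _ < _ := sum_lt_sum_of_nonempty univ_nonempty fun i _ => hlow i
  linarith

/-! ### Minimax -/

/-- A finite minimax theorem. -/
lemma exists_mixed_strategy {X H : Type*} [Fintype X] [Fintype H] [Nonempty H] (e : X → H → ℝ)
    {ε ε' : ℝ} (hε : ε < ε')
    (he : ∀ μ : X → ℝ, (∀ x, 0 ≤ μ x) → ∑ x, μ x = 1 → ∃ h, ∑ x, μ x * e x h ≤ ε) :
    ∃ ν : H → ℝ, (∀ h, 0 ≤ ν h) ∧ ∑ h, ν h = 1 ∧ ∀ x, ∑ h, ν h * e x h < ε' := by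
  classical
  let s : Set (X → ℝ) := Set.univ.pi fun _ => Set.Iio ε'
  let t : Set (X → ℝ) := (Matrix.of e).mulVecLin '' stdSimplex ℝ H
  -- A common point of the orthant `s` and the polytope `t` of expected errors is the wanted
  -- strategy. Otherwise a separating functional, normalised, is a distribution contradicting `he`.
  by_cases hd : Disjoint s t
  · exfalso
    obtain ⟨f, u, hfs, hft⟩ := geometric_hahn_banach_open (s := s) (t := t)
      (convex_pi fun _ _ => convex_Iio _) (isOpen_set_pi Set.finite_univ fun _ _ => isOpen_Iio)
      ((convex_stdSimplex ℝ H).linear_image _) hd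
    let a : X → ℝ := fun x => f (Pi.single x 1)
    have hf : ∀ v, f v = ∑ x, v x * a x := by
      intro v
      conv_lhs => rw [← Finset.univ_sum_single v, map_sum]
      refine sum_congr rfl fun x _ => ?_
      have : (Pi.single x (v x) : X → ℝ) = v x • Pi.single x 1 := by
        rw [← Pi.single_smul]; simp
      rw [this, map_smul]; rfl
    have hconst : (fun _ => ε) ∈ s := fun _ _ => hε
    -- `s` is unbounded below in each coordinate, so a negative coefficient would drive `f` up to
    -- `u` on it.
    have ha : ∀ x, 0 ≤ a x := by
      intro x
      by_contra! hx
      have h1 := fun r (hr : (0 : ℝ) ≤ r) => hfs ((fun _ => ε) - r • Pi.single x 1) (by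
        intro y _
        rcases eq_or_ne y x with rfl | hy
        · simp; linarith
        · simp [hy, hε])
      have h2 := h1 ((u - f fun _ => ε) / (- a x))
        (div_nonneg (by linarith [hfs _ hconst]) (by linarith))
      rw [map_sub, map_smul] at h2
      change _ - _ * a x < u at h2
      have : (u - f fun _ => ε) / (- a x) * a x = -(u - f fun _ => ε) := by
        rw [div_mul_eq_mul_div, div_eq_iff (by linarith)]
        ring
      linarith
    have hu : ∀ h, ε * ∑ x, a x < ∑ x, e x h * a x := by
      intro h
      have h1 := hfs _ hconst
      have h2 := hft (fun x => e x h) ⟨Pi.single h 1, single_mem_stdSimplex ℝ h, by ext x; simp⟩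
      rw [hf, ← mul_sum] at h1
      rw [hf] at h2
      linarith
    have hpos : 0 < ∑ x, a x := by
      rcases (sum_nonneg fun x _ => ha x : 0 ≤ ∑ x, a x).eq_or_lt with h | h
      · exfalso
        have h0 := (sum_eq_zero_iff_of_nonneg fun x _ => ha x).1 h.symm
        have h1 := hu (Classical.arbitrary H)
        rw [← h] at h1
        simp [fun x => h0 x (mem_univ x)] at h1
      · exact h
    obtain ⟨h, hh⟩ := he (fun x => a x / ∑ x, a x) (fun x => div_nonneg (ha x) hpos.le)
      (by rw [← sum_div, div_self hpos.ne'])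
    have h1 := hu h
    have h2 : ∑ x, a x / (∑ x, a x) * e x h = (∑ x, e x h * a x) / ∑ x, a x := by
      rw [sum_div]
      exact sum_congr rfl fun x _ => by ring
    rw [h2, div_le_iff₀ hpos] at hh
    linarith
  · obtain ⟨_, hvs, ν, hν, rfl⟩ := Set.not_disjoint_iff.1 hd
    refine ⟨ν, hν.1, hν.2, fun x => ?_⟩
    have h1 := hvs x trivial
    simpa [Matrix.mulVec, dotProduct, mul_comm] using h1

/-! ### Transversals by double sampling -/

open Classical in
-- Given one such `σ`, each pair with `(j, !σ j) ∈ S` forces every other such choice to agree with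
-- `σ` at `j`. Hence at least `r` coordinates are fixed.
lemma card_bad_swaps_le {s r : ℕ} (S : Finset (Fin s × Bool)) :
    #(univ.filter fun σ : Fin s → Bool =>
      (∀ j, (j, σ j) ∉ S) ∧ r ≤ #{j | (j, !σ j) ∈ S}) ≤ 2 ^ (s - r) := by
  by_cases h : ∃ σ : Fin s → Bool, (∀ j, (j, σ j) ∉ S) ∧ r ≤ #{j | (j, !σ j) ∈ S}
  · obtain ⟨σ, hσ, hr⟩ := h
    have hsub : (univ.filter fun τ : Fin s → Bool =>
        (∀ j, (j, τ j) ∉ S) ∧ r ≤ #{j | (j, !τ j) ∈ S}) ⊆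
        Fintype.piFinset fun j => if (j, !σ j) ∈ S then {σ j} else univ := by
      intro τ hτ
      rw [mem_filter] at hτ
      rw [Fintype.mem_piFinset]
      intro j
      split_ifs with hj
      · rw [mem_singleton]
        by_contra hne
        apply hτ.2.1 j
        rwa [Bool.eq_not_of_ne hne]
      · exact mem_univ _
    refine (card_le_card hsub).trans ?_
    rw [Fintype.card_piFinset]
    have h1 : ∀ j, #(if (j, !σ j) ∈ S then {σ j} else (univ : Finset Bool)) =
        if (j, !σ j) ∈ S then 1 else 2 := by
      intro j
      split_ifs <;> simp
    simp only [h1]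
    rw [prod_ite]
    simp only [prod_const, one_pow, one_mul]
    apply Nat.pow_le_pow_right (by norm_num)
    have := card_filter_add_card_filter_not (s := (univ : Finset (Fin s)))
      (fun j => (j, !σ j) ∈ S)
    simp only [card_univ, Fintype.card_fin] at this
    omega
  · push Not at h
    rw [filter_eq_empty_iff.2]
    · simp
    · intro σ _ hσ
      exact absurd hσ.2 (not_le.2 (h σ hσ.1))

lemma sum_prod_mul_apply {ι H : Type*} [Fintype ι] [DecidableEq ι] [Fintype H] {ν : H → ℝ}
    (hν1 : ∑ h, ν h = 1) (φ : H → ℝ) (i : ι) :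
    ∑ g : ι → H, (∏ j, ν (g j)) * φ (g i) = ∑ h, ν h * φ h := by
  have h1 : ∀ g : ι → H, (∏ j, ν (g j)) * φ (g i) =
      ∏ j, ν (g j) * if j = i then φ (g j) else 1 := by
    intro g
    rw [prod_mul_distrib]
    simp
  simp only [h1]
  rw [← Fintype.piFinset_univ, ← prod_univ_sum (fun _ => univ)
    (fun j h => ν h * if j = i then φ h else 1)]
  rw [prod_eq_single i]
  · simp
  · intro j _ hj
    simp [hj, hν1]
  · simp

open Classical in
/-- Sets of large measure from a family with few traces have a small common transversal. -/
lemma exists_transversal {H U : Type*} [Fintype H] (D : H → U → Prop) (r : ℕ)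
    (hD : ∀ p : Fin (2 * r) × Bool → H, 2 * #(traces D p) < 2 ^ r) (ν : H → ℝ)
    (hν : ∀ h, 0 ≤ ν h) (hν1 : ∑ h, ν h = 1)
    (hlarge : ∀ u, (∑ h, if D h u then 0 else ν h) ≤ 1 / 4) :
    ∃ h : Fin (2 * r) → H, ∀ u, ∃ j, D (h j) u := by
  by_contra! hcon
  -- Some `u` is missed by the whole first sample but hit at least `r` times by the second. This
  -- event has probability at least 1/2 by `hcon`, and below 1/2 by symmetry.
  let Bad : (Fin (2 * r) → H × H) → Prop := fun z =>
    ∃ u, (∀ j, ¬ D (z j).1 u) ∧ r ≤ #{j | D (z j).2 u}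
  let w : (Fin (2 * r) → H × H) → ℝ := fun z => ∏ j, ν (z j).1 * ν (z j).2
  have hw : ∀ z, 0 ≤ w z := fun z => prod_nonneg fun j _ => mul_nonneg (hν _) (hν _)
  have hpow : ∑ g : Fin (2 * r) → H, ∏ j, ν (g j) = 1 := by
    rw [← Fintype.sum_pow, hν1, one_pow]
  have hsplit : ∀ F : (Fin (2 * r) → H × H) → ℝ, ∑ z, w z * F z =
      ∑ h : Fin (2 * r) → H, (∏ j, ν (h j)) * ∑ g : Fin (2 * r) → H,
        (∏ j, ν (g j)) * F fun j => (h j, g j) := by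
    intro F
    rw [Fintype.sum_equiv (Equiv.arrowProdEquivProdArrow (Fin (2 * r)) (fun _ => H) (fun _ => H))
      _ (fun q => (∏ j, ν (q.1 j)) * ((∏ j, ν (q.2 j)) * F fun j => (q.1 j, q.2 j)))]
    · rw [Fintype.sum_prod_type]
      simp only [mul_sum]
    · intro z
      simp only [w, prod_mul_distrib, mul_assoc]
      rfl
  have hw1 : ∑ z, w z = 1 := by
    have := hsplit fun _ => 1
    simpa [hpow] using this
  have hr : 0 < r := by
    by_contra! h0
    obtain rfl : r = 0 := by omega
    obtain ⟨u, -⟩ := hcon Fin.elim0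
    have h1 := hD fun x => x.1.elim0
    have : 0 < #(traces D fun x : Fin (2 * 0) × Bool => (x.1.elim0 : H)) :=
      card_pos.2 ⟨∅, mem_traces.2 ⟨u, fun i => i.1.elim0⟩⟩
    omega
  have hrR : (0 : ℝ) < r := by exact_mod_cast hr
  have hlow : 1 / 2 ≤ ∑ z, w z * if Bad z then 1 else 0 := by
    rw [hsplit]
    calc (1 / 2 : ℝ) = ∑ h : Fin (2 * r) → H, (∏ j, ν (h j)) * (1 / 2) := by
          rw [← sum_mul, hpow, one_mul]
      _ ≤ _ := by
        refine sum_le_sum fun h _ => mul_le_mul_of_nonneg_left ?_ (prod_nonneg fun j _ => hν _)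
        obtain ⟨u, hu⟩ := hcon h
        -- Markov's inequality: at most `r / 2` misses are expected among `2 * r` draws.
        have hb : ∀ g : Fin (2 * r) → H,
            1 - (∑ j, if D (g j) u then 0 else 1) / r ≤
              (if Bad fun j => (h j, g j) then 1 else 0 : ℝ) := by
          intro g
          split_ifs with hB
          · rw [sub_le_self_iff]
            positivity
          · have h1 : #{j | D (g j) u} < r := by
              by_contra! h2
              exact hB ⟨u, hu, h2⟩
            have h2 := card_filter_add_card_filter_not (s := (univ : Finset (Fin (2 * r))))
              (fun j => D (g j) u)
            simp only [card_univ, Fintype.card_fin] at h2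
            have h3 : (∑ j, if D (g j) u then (0 : ℝ) else 1) = #{j | ¬ D (g j) u} := by
              rw [card_filter]
              push_cast
              exact sum_congr rfl fun j _ => by by_cases h : D (g j) u <;> simp [h]
            rw [h3, sub_nonpos, one_le_div hrR]
            exact_mod_cast (by omega : r ≤ #{j | ¬ D (g j) u})
        calc (1 / 2 : ℝ) = 1 - (∑ j : Fin (2 * r), (1 / 4 : ℝ)) / r := by
              simp; field_simp; norm_num
          _ ≤ 1 - (∑ j : Fin (2 * r), ∑ g : Fin (2 * r) → H,
                (∏ j, ν (g j)) * if D (g j) u then 0 else 1) / r := by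
              gcongr with j
              rw [sum_prod_mul_apply hν1 (fun h => if D h u then 0 else 1) j]
              refine le_trans (le_of_eq (sum_congr rfl fun h _ => ?_)) (hlarge u)
              split_ifs <;> simp
          _ = ∑ g : Fin (2 * r) → H, (∏ j, ν (g j)) *
                (1 - (∑ j, if D (g j) u then 0 else 1) / r) := by
              simp only [mul_sub, sum_sub_distrib, mul_one, hpow]
              rw [sum_comm, sum_div]
              congr 1
              refine sum_congr rfl fun g _ => ?_
              rw [← mul_sum, mul_div_assoc]
          _ ≤ _ := sum_le_sum fun g _ =>
              mul_le_mul_of_nonneg_left (hb g) (prod_nonneg fun j _ => hν _)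
  let sw : (Fin (2 * r) → Bool) → (Fin (2 * r) → H × H) → Fin (2 * r) → H × H :=
    fun σ z j => if σ j then (z j).swap else z j
  have hsw : ∀ σ, Function.Involutive (sw σ) := by
    intro σ z
    funext j
    by_cases h : σ j <;> simp [sw, h]
  have hinv : ∀ σ, ∑ z, w z * (if Bad (sw σ z) then 1 else 0) =
      ∑ z, w z * if Bad z then 1 else 0 := by
    intro σ
    refine Fintype.sum_equiv (hsw σ).toPerm _ _ fun z => ?_
    have : w (sw σ z) = w z := by
      refine prod_congr rfl fun j _ => ?_
      by_cases h : σ j <;> simp [sw, h, mul_comm]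
    change _ = w (sw σ z) * (if Bad (sw σ z) then 1 else 0)
    rw [this]
  -- Each trace on the `4 * r` points of `z` accounts for at most `2 ^ r` bad swaps, and there are
  -- fewer than `2 ^ r / 2` traces.
  have hcount : ∀ z, (∑ σ, if Bad (sw σ z) then 1 else 0 : ℝ) ≤ (2 ^ (2 * r) - 1) / 2 := by
    intro z
    let p : Fin (2 * r) × Bool → H := fun q => if q.2 then (z q.1).2 else (z q.1).1
    have hsub : (univ.filter fun σ => Bad (sw σ z)) ⊆ (traces D p).biUnion fun S =>
        univ.filter fun σ : Fin (2 * r) → Bool =>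
          (∀ j, (j, σ j) ∉ S) ∧ r ≤ #{j | (j, !σ j) ∈ S} := by
      intro σ hσ
      rw [mem_filter] at hσ
      obtain ⟨-, u, h1, h2⟩ := hσ
      rw [mem_biUnion]
      refine ⟨univ.filter fun q => D (p q) u, mem_traces.2 ⟨u, by simp⟩, ?_⟩
      have e1 : ∀ j, p (j, σ j) = (sw σ z j).1 := by
        intro j
        by_cases h : σ j <;> simp [p, sw, h]
      have e2 : ∀ j, p (j, !σ j) = (sw σ z j).2 := by
        intro j
        by_cases h : σ j <;> simp [p, sw, h]
      simpa [e1, e2] using ⟨h1, h2⟩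
    have h1 := (card_le_card hsub).trans
      (card_biUnion_le_card_mul _ _ _ fun S _ => card_bad_swaps_le S)
    have h2 : 2 * #(traces D p) * 2 ^ (2 * r - r) + 1 ≤ 2 ^ r * 2 ^ (2 * r - r) :=
      Nat.succ_le_of_lt (Nat.mul_lt_mul_of_pos_right (hD p) (by positivity))
    rw [← pow_add, show r + (2 * r - r) = 2 * r by omega] at h2
    have h3 : 2 * #(univ.filter fun σ => Bad (sw σ z)) + 1 ≤ 2 ^ (2 * r) := by
      refine le_trans ?_ h2
      rw [mul_assoc]
      omega
    have h4 : (2 * #(univ.filter fun σ => Bad (sw σ z)) + 1 : ℝ) ≤ 2 ^ (2 * r) := by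
      exact_mod_cast h3
    rw [sum_boole]
    linarith
  have htot : ∑ σ : Fin (2 * r) → Bool, ∑ z, w z * (if Bad (sw σ z) then 1 else 0) ≤
      (2 ^ (2 * r) - 1) / 2 := by
    rw [sum_comm]
    calc _ ≤ ∑ z, w z * ((2 ^ (2 * r) - 1) / 2) := by
          refine sum_le_sum fun z _ => ?_
          rw [← mul_sum]
          exact mul_le_mul_of_nonneg_left (hcount z) (hw z)
      _ = _ := by rw [← sum_mul, hw1, one_mul]
  simp only [hinv, sum_const, card_univ, Fintype.card_fun, Fintype.card_bool, Fintype.card_fin,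
    nsmul_eq_mul] at htot
  push_cast at htot
  have h2 : (0 : ℝ) < 2 ^ (2 * r) := by positivity
  nlinarith

/-! ### Sample sizes and separation by boundedly many hypotheses -/

lemma eventually_linear_pow_lt_two_pow (a b d : ℕ) :
    ∃ n, 2 * (a * n + b) ^ d < 2 ^ n := by
  have h := tendsto_pow_const_div_const_pow_of_one_lt d (r := (2 : ℝ)) (by norm_num)
  have h2 := (h.const_mul (2 * (a + b : ℝ) ^ d))
  rw [mul_zero] at h2
  obtain ⟨n, hn, hn1⟩ := ((h2.eventually_lt_const (zero_lt_one)).and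
    (Filter.eventually_ge_atTop 1)).exists
  refine ⟨n, ?_⟩
  rw [← mul_div_assoc, div_lt_one (by positivity)] at hn
  have : (2 * (a * n + b) ^ d : ℝ) < 2 ^ n := by
    refine lt_of_le_of_lt ?_ hn
    rw [mul_assoc, ← mul_pow]
    have h1 : (1 : ℝ) ≤ n := by exact_mod_cast hn1
    gcongr
    nlinarith [(Nat.cast_nonneg b : (0 : ℝ) ≤ b)]
  exact_mod_cast this

open Classical in
/-- If `c` is approximated, for each distribution, by some set `Θ(·, h)`, then `c` is a Boolean
combination of boundedly many of these sets. -/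
lemma exists_separating_parameters {X H : Type*} [Fintype X] [Fintype H] [Nonempty H]
    (Θ : X → H → Prop) (c : X → Prop) {δ : ℝ} (hδ : δ < 1 / 8) (r : ℕ)
    (he : ∀ μ : X → ℝ, (∀ x, 0 ≤ μ x) → ∑ x, μ x = 1 →
      ∃ h, (∑ x, if Θ x h ↔ c x then 0 else μ x) ≤ δ)
    (hr : ∀ p : Fin (2 * r) × Bool → H, 2 * #(traces (fun h x => Θ x h) p) ^ 2 < 2 ^ r) :
    ∃ h : Fin (2 * r) → H, ∀ x x', (∀ j, Θ x (h j) ↔ Θ x' (h j)) → c x → c x' := by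
  obtain ⟨ν, hν, hν1, hνe⟩ := exists_mixed_strategy
    (fun x h => if Θ x h ↔ c x then 0 else 1) hδ (by
      intro μ h0 h1
      obtain ⟨h, hh⟩ := he μ h0 h1
      refine ⟨h, hh.trans' (le_of_eq (sum_congr rfl fun x _ => ?_))⟩
      split_ifs <;> simp)
  -- Traces of the separation relation are symmetric differences of two traces of `Θ`, whence the
  -- square in `hr`. A hypothesis not separating `x` from `x'` errs at one of them: total
  -- probability at most 1/8 + 1/8.
  obtain ⟨h, hh⟩ := exists_transversal
    (U := {u : X × X // c u.1 ∧ ¬ c u.2}) (fun h u => ¬ (Θ u.1.1 h ↔ Θ u.1.2 h)) r (by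
      intro p
      refine lt_of_le_of_lt (Nat.mul_le_mul_left 2 ?_) (hr p)
      rw [sq, ← card_product]
      refine (card_le_card ?_).trans (card_image_le (f := fun q => symmDiff q.1 q.2))
      intro S hS
      obtain ⟨⟨u, hu⟩, hS⟩ := mem_traces.1 hS
      rw [mem_image]
      refine ⟨(univ.filter fun i => Θ u.1 (p i), univ.filter fun i => Θ u.2 (p i)),
        mem_product.2 ⟨mem_traces.2 ⟨u.1, by simp⟩, mem_traces.2 ⟨u.2, by simp⟩⟩, ?_⟩
      ext i
      rw [hS]
      simp only [mem_symmDiff, mem_filter, mem_univ, true_and]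
      tauto) ν hν hν1 (by
      rintro ⟨⟨x, x'⟩, hx, hx'⟩
      refine le_trans ?_ ((add_le_add (hνe x).le (hνe x').le).trans (by norm_num))
      rw [← sum_add_distrib]
      refine sum_le_sum fun h _ => ?_
      have := hν h
      simp only [hx, hx', iff_true, iff_false]
      by_cases h1 : Θ x h <;> by_cases h2 : Θ x' h <;> simp [h1, h2, this])
  refine ⟨h, fun x x' hxx hx => ?_⟩
  by_contra hx'
  obtain ⟨j, hj⟩ := hh ⟨(x, x'), hx, hx'⟩
  exact hj (hxx j)

/-! ### Compactness, Boolean combinations and coding of formulas -/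

namespace FirstOrder.Language

variable {L : Language.{u, v}}

/-- An NIP formula shatters no set of `d` tuples, for some `d` depending only on the formula. -/
lemma Theory.FormulaIsNIP.exists_not_shattered {T : L.Theory} {n m : ℕ}
    {φ : L.Formula (Fin n ⊕ Fin m)} (hφ : T.FormulaIsNIP φ) :
    ∃ d : ℕ, ∀ (M : Type w) [L.Structure M] [Nonempty M] [M ⊨ T] (a : Fin d → Fin n → M),
      ¬ ∀ s : Set (Fin d), ∃ b : Fin m → M, ∀ i, φ.Realize (Sum.elim (a i) b) ↔ i ∈ s := by
  classical
  by_contra! hcon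
  let C := (ℕ × Fin n) ⊕ (Set ℕ × Fin m)
  let ψ : ℕ × Set ℕ → L.Formula C := fun p =>
    φ.relabel (Sum.map (fun i => (p.1, i)) (fun j => (p.2, j)))
  let lit : ℕ × Set ℕ → L[[C]].Sentence := fun p =>
    Formula.equivSentence (if p.1 ∈ p.2 then ψ p else ∼(ψ p))
  -- `T' N` involves every `s` but only `t < N`, so `N` shattered tuples satisfy it, with `b_s` the
  -- witness for the trace of `s` on `{0, …, N - 1}`.
  let T' : ℕ → L[[C]].Theory := fun N =>
    (L.lhomWithConstants C).onTheory T ∪ lit '' {p | p.1 < N}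
  have hsat : ∀ N, (T' N).IsSatisfiable := by
    intro N
    obtain ⟨M, _, _, _, a, ha⟩ := hcon N
    choose b hb using ha
    let v : C → M := Sum.elim
      (fun q => if h : q.1 < N then a ⟨q.1, h⟩ q.2 else Classical.arbitrary M)
      (fun q => b {i | (i : ℕ) ∈ q.1} q.2)
    let _ := constantsOn.structure v
    have hm : M ⊨ T' N := by
      refine ((LHom.onTheory_model _ _).2 inferInstance).union ⟨?_⟩
      rintro _ ⟨⟨t, s⟩, ht, rfl⟩
      change t < N at ht
      have key : (ψ (t, s)).Realize v ↔ t ∈ s := by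
        have h1 := hb {i | (i : ℕ) ∈ s} ⟨t, ht⟩
        rw [Formula.realize_relabel]
        have h2 : v ∘ Sum.map (fun i => (t, i)) (fun j => (s, j)) =
            Sum.elim (a ⟨t, ht⟩) (b {i | (i : ℕ) ∈ s}) := by
          ext (i | j)
          · simp [v, ht]
          · simp [v]
        exact (iff_of_eq (congrArg _ h2)).trans h1
      refine (Formula.realize_equivSentence M _).2 ?_
      change (if t ∈ s then ψ (t, s) else ∼(ψ (t, s))).Realize v
      split_ifs with hts
      · exact key.2 hts
      · rw [Formula.realize_not, key]
        exact hts
    exact Theory.Model.isSatisfiable M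
  have hdir : Directed (· ⊆ ·) T' := by
    apply Monotone.directed_le
    intro N N' h
    exact Set.union_subset_union_right _ (Set.image_mono fun p hp => lt_of_lt_of_le hp h)
  obtain ⟨N⟩ := (Theory.isSatisfiable_directed_union_iff hdir).2 hsat
  let _ := (L.lhomWithConstants C).reduct N
  have hmod := N.is_model
  have hNT : N ⊨ T := (LHom.onTheory_model (L.lhomWithConstants C) T).1
    (hmod.mono (Set.subset_union_left.trans (Set.subset_iUnion T' 0)))
  refine hφ N ⟨fun t i => (L.con (Sum.inl (t, i) : C) : N),
    fun s j => (L.con (Sum.inr (s, j) : C) : N), fun t s => ?_⟩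
  have h1 : N ⊨ lit (t, s) := hmod.realize_of_mem _
    (Set.mem_iUnion.2 ⟨t + 1, Or.inr ⟨(t, s), Nat.lt_succ_self t, rfl⟩⟩)
  have h2 := (Formula.realize_equivSentence N _).1 h1
  have h3 : (ψ (t, s)).Realize (fun c => (L.con c : N)) ↔
      φ.Realize (Sum.elim (fun i => (L.con (Sum.inl (t, i) : C) : N))
        fun j => (L.con (Sum.inr (s, j) : C) : N)) := by
    rw [Formula.realize_relabel]
    refine iff_of_eq (congrArg _ ?_)
    ext (i | j) <;> rfl
  rw [← h3]
  dsimp only at h2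
  split_ifs at h2 with hts
  · exact iff_of_true h2 hts
  · exact iff_of_false (by simpa using h2) hts

open Classical in
/-- The Boolean combination of the formulas `ψ j` given by the truth function `F`. -/
noncomputable def Formula.boolComb {α J : Type*} [Finite J] (ψ : J → L.Formula α)
    (F : Finset J → Prop) : L.Formula α :=
  have := Fintype.ofFinite J
  Formula.iSup fun S : {S : Finset J // F S} =>
    Formula.iInf fun j => if j ∈ S.1 then ψ j else ∼(ψ j)

open Classical in
lemma Formula.realize_boolComb {α J M : Type*} [Fintype J] [L.Structure M] {ψ : J → L.Formula α}
    {F : Finset J → Prop} {v : α → M} :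
    (Formula.boolComb ψ F).Realize v ↔ F (univ.filter fun j => (ψ j).Realize v) := by
  have hlit : ∀ (S : Finset J) (j : J),
      (if j ∈ S then ψ j else ∼(ψ j)).Realize v ↔ (j ∈ S ↔ (ψ j).Realize v) := by
    intro S j
    split_ifs with h <;> simp [h]
  simp only [Formula.boolComb, Formula.realize_iSup, Formula.realize_iInf, hlit, Subtype.exists]
  constructor
  · rintro ⟨S, hS, h⟩
    convert hS
    ext j
    simp [h]
  · intro h
    exact ⟨_, h, by simp⟩

/-- Finitely many formulas are instances of a single one, with parameters from any set with two
elements coding the choice of the formula. -/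
lemma exists_uniform_formula {n : ℕ} {E κ : Type*} [Finite E] [Finite κ]
    (θ : E → L.Formula (Fin n ⊕ κ)) :
    ∃ (k : ℕ) (Θ : L.Formula (Fin n ⊕ Fin k)), ∀ (M : Type w) [L.Structure M] (A : Set M),
      A.Nontrivial → ∀ (e : E) (b : κ → M), (∀ j, b j ∈ A) →
        ∃ b' : Fin k → M, (∀ j, b' j ∈ A) ∧
          ∀ c, Θ.Realize (Sum.elim c b') ↔ (θ e).Realize (Sum.elim c b) := by
  classical
  obtain ⟨k, ⟨f⟩⟩ := Finite.exists_equiv_fin (κ ⊕ E × Bool)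
  -- The parameters at `(e, false)` and `(e, true)` form a switch: their equality selects `e`.
  let Ψ : L.Formula (Fin n ⊕ (κ ⊕ E × Bool)) := Formula.iSup fun e =>
    Term.equal (Term.var (Sum.inr (Sum.inr (e, false)))) (Term.var (Sum.inr (Sum.inr (e, true)))) ⊓
      (θ e).relabel (Sum.map id Sum.inl)
  refine ⟨k, Ψ.relabel (Sum.map id f), fun M _ A hA e b hb => ?_⟩
  obtain ⟨a₀, h₀, a₁, h₁, hne⟩ := hA
  let g : κ ⊕ E × Bool → M := Sum.elim b fun q => if q.1 = e ∨ q.2 = true then a₀ else a₁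
  refine ⟨g ∘ f.symm, fun j => ?_, fun c => ?_⟩
  · have : ∀ q, g q ∈ A := by
      rintro (q | q)
      · exact hb q
      · simp only [g, Sum.elim_inr]
        split_ifs <;> assumption
    exact this _
  · have e1 : (Sum.elim c (g ∘ f.symm)) ∘ (Sum.map id f) = Sum.elim c g := by
      ext (i | j) <;> simp
    have e2 : (Sum.elim c g) ∘ (Sum.map id Sum.inl) = Sum.elim c b := by
      ext (i | j) <;> simp [g]
    rw [Formula.realize_relabel, e1]
    simp only [Ψ, Formula.realize_iSup, Formula.realize_inf, Formula.realize_equal,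
      Formula.realize_relabel, e2, Term.realize_var, Sum.elim_inr, g]
    constructor
    · rintro ⟨e', h, h'⟩
      by_cases hee : e' = e
      · rwa [hee] at h'
      · simp [hee] at h
        exact absurd h.symm hne
    · intro h
      exact ⟨e, by simp, h⟩

end FirstOrder.Language

/-! ### The leave-one-out formula -/

namespace FirstOrder.Language

variable {L : Language.{u, v}}

/-- The formula predicting, by leave-one-out, the truth value at `x` from the trace of `φ` on the
parameter tuples together with `x`, in position `i`. -/
noncomputable def Formula.leaveOneOut {n m : ℕ} (φ : L.Formula (Fin n ⊕ Fin m)) (s k : ℕ)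
    (i : Fin (s + 1)) (l : Finset (Fin (s + 1))) : L.Formula (Fin n ⊕ Fin s × Fin n) :=
  -- The atom for `S` says that some tuple `b` of the model cuts out exactly `S`. The outer truth
  -- function thus receives the whole trace family, and `b` is not a parameter.
  Formula.boolComb (fun S : Finset (Fin (s + 1)) => Formula.iExs (Fin m) <|
    Formula.boolComb (fun j => φ.relabel (Sum.map (fun t =>
      Fin.insertNth (α := fun _ => Fin n ⊕ Fin s × Fin n) i (Sum.inl t)
        (fun j' => Sum.inr (j', t)) j) id))
      fun S' => S' = S) fun V => _root_.leaveOneOut k V i l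

lemma Formula.realize_leaveOneOut {n m : ℕ} (φ : L.Formula (Fin n ⊕ Fin m)) (s k : ℕ)
    (i : Fin (s + 1)) (l : Finset (Fin (s + 1))) {M X : Type*} [L.Structure M]
    (f : X → Fin n → M) (x : X) (Y : Fin s → X) :
    (φ.leaveOneOut s k i l).Realize (Sum.elim (f x) fun q => f (Y q.1) q.2) ↔
      _root_.leaveOneOut k (traces (fun x (b : Fin m → M) => φ.Realize (Sum.elim (f x) b))
        (i.insertNth x Y : Fin (s + 1) → X)) i l := by
  classical
  rw [Formula.leaveOneOut, Formula.realize_boolComb]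
  refine iff_of_eq (congrArg (fun V => _root_.leaveOneOut k V i l) ?_)
  ext S
  rw [mem_filter, mem_traces]
  simp only [mem_univ, true_and, Formula.realize_iExs, Formula.realize_boolComb,
    Formula.realize_relabel]
  refine exists_congr fun b => ?_
  have h : ∀ j, (Sum.elim (Sum.elim (f x) fun q : Fin s × Fin n => f (Y q.1) q.2) b) ∘
      (Sum.map (fun t => Fin.insertNth (α := fun _ => Fin n ⊕ Fin s × Fin n) i (Sum.inl t)
        (fun j' => Sum.inr (j', t)) j) id) =
      Sum.elim (f ((i.insertNth x Y : Fin (s + 1) → X) j)) b := by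
    intro j
    ext (t | t)
    · rcases Fin.eq_self_or_eq_succAbove i j with rfl | ⟨j, rfl⟩ <;> simp
    · simp
  simp only [h]
  rw [Finset.ext_iff]
  simp only [mem_filter, mem_univ, true_and]
  exact forall_congr' fun j => Iff.comm

end FirstOrder.Language

/-! ### The main theorem -/

open FirstOrder.Language in
theorem mainTheorem2 {L : FirstOrder.Language.{u, v}} (T : L.Theory)
    (hT : T.IsComplete) (hNIP : T.IsNIP) :
    FirstOrder.Language.Theory.SatisfiesUDTFS.{u, v, w} T := by
  classical
  intro n m φ
  obtain ⟨d, hd⟩ := Theory.FormulaIsNIP.exists_not_shattered.{u, v, w} (hNIP n m φ)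
  -- With `s + 1 = 8 * k + 2` the error `k / (s + 1)` is below 1/8, and `8 * k + 3` is the base of
  -- the Sauer–Shelah bound for `s + 1` points.
  obtain ⟨k, hk⟩ := eventually_linear_pow_lt_two_pow 8 3 d
  let s := 8 * k + 1
  obtain ⟨k', Θ, hΘ⟩ := exists_uniform_formula.{u, v, w}
    fun e : Fin (s + 1) × Finset (Fin (s + 1)) => φ.leaveOneOut s k e.1 e.2
  -- The transversal needs the dual relation, in which hypotheses are the points and tuples `x` the
  -- parameters.
  obtain ⟨d', hd'⟩ := Theory.FormulaIsNIP.exists_not_shattered.{u, v, w}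
    (hNIP k' n (Θ.relabel Sum.swap))
  -- `4 * r` sample hypotheses, with the exponent doubled for pairs of traces.
  obtain ⟨r, hr⟩ := eventually_linear_pow_lt_two_pow 4 1 (d' * 2)
  obtain ⟨K, θ, hθ⟩ := exists_uniform_formula.{u, v, w}
    fun F : Finset (Finset (Fin (2 * r))) => Formula.boolComb
      (fun j => Θ.relabel (Sum.map id fun t => ((j, t) : Fin (2 * r) × Fin k'))) fun S => S ∈ F
  refine ⟨K, θ, fun M _ _ _ A hA hA2 a => ?_⟩
  have hAn : A.Nontrivial := (Set.one_lt_ncard_iff_nontrivial_and_finite.1 hA2).1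
  have := hA.fintype
  have : Nonempty A := hAn.nonempty.to_subtype
  have hswap : ∀ (h : Fin k' → M) (x : Fin n → M),
      (Θ.relabel Sum.swap).Realize (Sum.elim h x) ↔ Θ.Realize (Sum.elim x h) := by
    intro h x
    rw [Formula.realize_relabel]
    refine iff_of_eq (congrArg _ ?_)
    ext (i | i) <;> rfl
  obtain ⟨h, hh⟩ := exists_separating_parameters
    (X := Fin n → A) (H := Fin k' → A)
    (fun x h => Θ.Realize (Sum.elim (fun i => (x i : M)) fun j => (h j : M)))
    (fun x => φ.Realize (Sum.elim (fun i => (x i : M)) a))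
    (δ := (k : ℝ) / (s + 1)) (by
      rw [div_lt_div_iff₀ (by positivity) (by norm_num)]
      simp only [s]
      push_cast
      linarith) r (by
      intro μ hμ hμ1
      obtain ⟨i, l, Y, hY⟩ := exists_leaveOneOut_error_le (X := Fin n → A) (B := Fin m → M)
        (fun x b => φ.Realize (Sum.elim (fun i => (x i : M)) b)) (s := s) (k := k) (by
          intro p
          refine lt_of_le_of_lt (card_traces_le (d := d) (fun a : Fin d → Fin n → A =>
            hd M fun i t => (a i t : M)) p) ?_
          rw [Fintype.card_fin]
          have : s + 1 + 1 = 8 * k + 3 := rfl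
          rw [this, pow_succ]
          omega) a μ hμ hμ1
      obtain ⟨b, hbA, hb⟩ := hΘ M A hAn (i, l) (fun q => (Y q.1 q.2 : M)) fun q => (Y q.1 q.2).2
      refine ⟨fun j => ⟨b j, hbA j⟩, le_trans (le_of_eq (sum_congr rfl fun x _ => ?_)) hY⟩
      have h1 := φ.realize_leaveOneOut s k i l (fun (x : Fin n → A) i => (x i : M)) x Y
      simp only [hb, h1]) (by
      intro p
      have h1 := card_traces_le (d := d')
        (R := fun (h : Fin k' → A) (x : Fin n → A) =>
          Θ.Realize (Sum.elim (fun i => (x i : M)) fun j => (h j : M))) (by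
          intro c hc
          refine hd' M (fun i j => (c i j : M)) fun S => ?_
          obtain ⟨b, hb⟩ := hc S
          exact ⟨fun i => b i, fun i => (hswap _ _).trans (hb i)⟩) p
      have h2 : Fintype.card (Fin (2 * r) × Bool) + 1 = 4 * r + 1 := by
        simp
        ring
      rw [h2] at h1
      refine lt_of_le_of_lt ?_ hr
      rw [pow_mul]
      gcongr)
  let pat : (Fin n → A) → Finset (Fin (2 * r)) := fun x =>
    univ.filter fun j => Θ.Realize (Sum.elim (fun i => (x i : M)) fun t => (h j t : M))
  -- By `hh`, a pattern of a point in the trace is shared by no point outside it.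
  let F : Finset (Finset (Fin (2 * r))) :=
    univ.filter fun S => ∃ x, φ.Realize (Sum.elim (fun i => (x i : M)) a) ∧ pat x = S
  obtain ⟨b, hbA, hb⟩ := hθ M A hAn F (fun q => (h q.1 q.2 : M)) fun q => (h q.1 q.2).2
  refine ⟨b, hbA, Set.ext fun c => and_congr_right fun hc => ?_⟩
  rw [hb, Formula.realize_boolComb]
  let x : Fin n → A := fun i => ⟨c i, hc i⟩
  have hpat : (univ.filter fun j => (Θ.relabel (Sum.map id fun t =>
      ((j, t) : Fin (2 * r) × Fin k'))).Realize (Sum.elim c fun q => (h q.1 q.2 : M))) = pat x := by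
    refine filter_congr fun j _ => ?_
    rw [Formula.realize_relabel]
    refine iff_of_eq (congrArg _ ?_)
    ext (i | i) <;> rfl
  rw [hpat]
  simp only [F, mem_filter, mem_univ, true_and]
  constructor
  · exact fun hφ => ⟨x, hφ, rfl⟩
  · rintro ⟨x', hx', hxx⟩
    refine hh x' x (fun j => ?_) hx'
    have : j ∈ pat x' ↔ j ∈ pat x := by rw [hxx]
    simpa [pat] using this
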